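/- Let $H$ be a complex Hilbert space. A *JC\*-algebra* on $H$ is a norm-closed complex linear subspace $A\subseteq B(H)$ that is closed under the Jordan product $a\circ b=\tfrac12(ab+ba)$ and under the adjoint $a\mapsto a^*$; it is *unital* if it contains an element $e$ with $\|e\|=1$ and $e\circ a=a$ for all $a\in A$. Let $A\subseteq B(H)$ and $B\subseteq B(K)$ be JC\*-algebras. A map $T:A\to B(K)$ is *completely isometric* if $\|[T(a_{ij})]\|_{M_m(B(K))}=\|[a_{ij}]\|_{M_m(B(H))}$ for all $m\in\mathbb N$ and all $[a_{ij}]\in M_m(A)$; $A$ and $B$ are *linearly completely isometric* if there is a linear completely isometric map of $A$ onto $B$. They are *Jordan isomorphic* if there is a linear bijection $T:A\to B$ with $T(a\circ b)=T(a)\circ T(b)$ for all $a,b\in A$, and *Jordan $*$-isomorphic* if $T$ can in addition be chosen with $T(a^*)=T(a)^*$ for all $a\in A$. 1. There exist unital JC\*-algebras that are linearly completely isometric but not Jordan isomorphic. 2. There exist unital JC\*-algebras that are Jordan $*$-isomorphic but not linearly completely isometric. 3. An example for (2) is the following. Let $n\ge 2$, let $M_n=B(\mathbb C^n)$, and let $R_n=\{(x,x^{\mathsf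 T}) : x\in M_n\}\subseteq M_n\oplus M_n\subseteq B(\mathbb C^n\oplus\mathbb C^n)$. Then $M_n$ and $R_n$ are unital JC\*-algebras, the map $x\mapsto (x,x^{\mathsf T})$ is a Jordan $*$-isomorphism of $M_n$ onto $R_n$, and $M_n$ and $R_n$ are not linearly completely isometric. Moreover the transpose map $x\mapsto x^{\mathsf T}$ on $M_n$ is not completely isometric. -/

import Mathlib

/-- The Jordan product `a ∘ b = (ab + ba) / 2` of two bounded operators. -/
noncomputable def jordanProd {H : Type*} [NormedAddCommGroup H] [InnerProductSpace ℂ H]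
    (a b : H →L[ℂ] H) : H →L[ℂ] H :=
  (2⁻¹ : ℂ) • (a * b + b * a)

/-- A `JC*`-algebra on the complex Hilbert space `H`: a norm-closed linear subspace of `B(H)` that
is closed under the Jordan product and under the adjoint. -/
structure IsJCStarAlgebra {H : Type*} [NormedAddCommGroup H] [InnerProductSpace ℂ H]
    [CompleteSpace H] (A : Submodule ℂ (H →L[ℂ] H)) : Prop where
  isClosed : IsClosed (A : Set (H →L[ℂ] H))
  jordanProd_mem : ∀ a ∈ A, ∀ b ∈ A, jordanProd a b ∈ A
  star_mem : ∀ a ∈ A, star a ∈ A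

/-- A unital `JC*`-algebra: one with an identity element (for the Jordan product) of norm `1`. -/
structure IsUnitalJCStarAlgebra {H : Type*} [NormedAddCommGroup H] [InnerProductSpace ℂ H]
    [CompleteSpace H] (A : Submodule ℂ (H →L[ℂ] H)) : Prop extends IsJCStarAlgebra A where
  exists_unit : ∃ e ∈ A, ‖e‖ = 1 ∧ ∀ a ∈ A, jordanProd e a = a

section Maps

variable {H K : Type*} [NormedAddCommGroup H] [InnerProductSpace ℂ H] [CompleteSpace H]
  [NormedAddCommGroup K] [InnerProductSpace ℂ K] [CompleteSpace K]

/-- `T : A → B(K)` is completely isometric: for every `m` its entrywise action on `m × m` matrices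
over `A` preserves the norm, the norms being the C*-norms of `M_m(B(H))` and `M_m(B(K))`. -/
def IsCompletelyIsometric (A : Submodule ℂ (H →L[ℂ] H)) (T : A → (K →L[ℂ] K)) : Prop :=
  ∀ (m : ℕ) (x : Matrix (Fin m) (Fin m) A),
    ‖CStarMatrix.ofMatrix (x.map T)‖ =
      ‖CStarMatrix.ofMatrix (x.map (fun a : A => (a : H →L[ℂ] H)))‖

/-- `A` and `B` are linearly completely isometric: there is a linear completely isometric map of
`A` onto `B`. -/
def LinearlyCompletelyIsometric (A : Submodule ℂ (H →L[ℂ] H)) (B : Submodule ℂ (K →L[ℂ] K)) :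
    Prop :=
  ∃ T : A ≃ₗ[ℂ] B, IsCompletelyIsometric A (fun a => (T a : K →L[ℂ] K))

/-- A linear bijection `T : A → B` is a Jordan isomorphism if `T (a ∘ b) = T a ∘ T b`. (The element
`c` is `a ∘ b`, regarded as an element of `A`.) -/
def IsJordanIso {A : Submodule ℂ (H →L[ℂ] H)} {B : Submodule ℂ (K →L[ℂ] K)}
    (T : A ≃ₗ[ℂ] B) : Prop :=
  ∀ a b c : A, (c : H →L[ℂ] H) = jordanProd (a : H →L[ℂ] H) b →
    (T c : K →L[ℂ] K) = jordanProd (T a : K →L[ℂ] K) (T b)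

/-- A Jordan `*`-isomorphism is a Jordan isomorphism with `T (a*) = (T a)*`. (The element `c` is
`a*`, regarded as an element of `A`.) -/
def IsJordanStarIso {A : Submodule ℂ (H →L[ℂ] H)} {B : Submodule ℂ (K →L[ℂ] K)}
    (T : A ≃ₗ[ℂ] B) : Prop :=
  IsJordanIso T ∧
    ∀ a c : A, (c : H →L[ℂ] H) = star (a : H →L[ℂ] H) →
      (T c : K →L[ℂ] K) = star (T a : K →L[ℂ] K)

/-- `A` and `B` are Jordan isomorphic (no compatibility with norm or involution is required). -/
def JordanIsomorphic (A : Submodule ℂ (H →L[ℂ] H)) (B : Submodule ℂ (K →L[ℂ] K)) : Prop :=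
  ∃ T : A ≃ₗ[ℂ] B, IsJordanIso T

/-- `A` and `B` are Jordan `*`-isomorphic. -/
def JordanStarIsomorphic (A : Submodule ℂ (H →L[ℂ] H)) (B : Submodule ℂ (K →L[ℂ] K)) : Prop :=
  ∃ T : A ≃ₗ[ℂ] B, IsJordanStarIso T

end Maps

/-- The matrix algebra `M_n`, identified with all of `B(ℂⁿ)`. -/
noncomputable def matrixAlgebra (n : ℕ) :
    Submodule ℂ (EuclideanSpace ℂ (Fin n) →L[ℂ] EuclideanSpace ℂ (Fin n)) := ⊤

/-- The transpose on `M_n = B(ℂⁿ)`. -/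
noncomputable def transposeOp (n : ℕ)
    (x : EuclideanSpace ℂ (Fin n) →L[ℂ] EuclideanSpace ℂ (Fin n)) :
    EuclideanSpace ℂ (Fin n) →L[ℂ] EuclideanSpace ℂ (Fin n) :=
  Matrix.toEuclideanCLM (n := Fin n) (𝕜 := ℂ)
    (Matrix.transpose ((Matrix.toEuclideanCLM (n := Fin n) (𝕜 := ℂ)).symm x))

/-- The linear map `d x = (x, xᵀ)` from `M_n` to `M_n ⊕ M_n`, where `M_n ⊕ M_n` is the algebra of
block diagonal operators on `ℂⁿ ⊕ ℂⁿ`. -/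
noncomputable def diagTranspose (n : ℕ) :
    (EuclideanSpace ℂ (Fin n) →L[ℂ] EuclideanSpace ℂ (Fin n)) →ₗ[ℂ]
      (EuclideanSpace ℂ (Fin n ⊕ Fin n) →L[ℂ] EuclideanSpace ℂ (Fin n ⊕ Fin n)) where
  toFun x :=
    let M := (Matrix.toEuclideanCLM (n := Fin n) (𝕜 := ℂ)).symm x
    Matrix.toEuclideanCLM (n := Fin n ⊕ Fin n) (𝕜 := ℂ)
      (Matrix.fromBlocks M 0 0 (Matrix.transpose M))
  map_add' x y := by
    rw [← map_add]
    simp only [map_add (Matrix.toEuclideanCLM (n := Fin n) (𝕜 := ℂ)).symm, Matrix.transpose_add,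
      Matrix.fromBlocks_add, add_zero]
  map_smul' c x := by
    rw [RingHom.id_apply, ← map_smul]
    simp only [map_smul (Matrix.toEuclideanCLM (n := Fin n) (𝕜 := ℂ)).symm, Matrix.transpose_smul,
      Matrix.fromBlocks_smul, smul_zero]

/-- The algebra `{(x, xᵀ) : x ∈ M_n} ⊆ M_n ⊕ M_n`. -/
noncomputable def diagTransposeAlgebra (n : ℕ) :
    Submodule ℂ (EuclideanSpace ℂ (Fin n ⊕ Fin n) →L[ℂ] EuclideanSpace ℂ (Fin n ⊕ Fin n)) :=
  LinearMap.range (diagTranspose n)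

/-!
Part 1. For a unitary `w` of `R = C(𝕋)` let `S_w ⊆ M₂(R)` be the space of matrices `x` with
`x₀₁ = w x₁₀`. Right multiplication by the unitary `diag(w*, 1)` maps the symmetric matrices `S₁`
completely isometrically onto `S_w`. The symmetric matrices contain two anticommuting square roots
of `1`; if `S_w` contains such a pair, with first columns `(a, b)` and `(c, d)`, then
`w (ad - bc)² = 1`, so that `w` is a square. The coordinate function on the circle is not a square.
The GNS representation of the faithful functional `x ↦ ∫ tr x` turns `M₂(R)` into operators.

Parts 2 and 3. The isometric antiautomorphism `(a, b) ↦ (bᵀ, aᵀ)` of `M_n ⊕ M_n` fixes every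
element of `{(x, xᵀ)}`, so rows and columns over this algebra have the same norm. In `M_n` the
family `e_{ij}`, `1 ≤ i ≤ n`, has norm `√n` as a column and norm `1` as a row.
-/

section JordanProduct

variable {H K : Type*} [NormedAddCommGroup H] [InnerProductSpace ℂ H]
  [NormedAddCommGroup K] [InnerProductSpace ℂ K]

theorem jordanProd_comm (a b : H →L[ℂ] H) : jordanProd a b = jordanProd b a := by
  rw [jordanProd, jordanProd, add_comm]

theorem jordanProd_self (a : H →L[ℂ] H) : jordanProd a a = a * a := by
  rw [jordanProd, ← two_smul ℂ, inv_smul_smul₀ two_ne_zero]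

theorem jordanProd_one_left (a : H →L[ℂ] H) : jordanProd 1 a = a := by
  rw [jordanProd, one_mul, mul_one, ← two_smul ℂ, inv_smul_smul₀ two_ne_zero]

theorem jordanProd_eq_zero_iff {a b : H →L[ℂ] H} : jordanProd a b = 0 ↔ a * b + b * a = 0 :=
  smul_eq_zero_iff_right (inv_ne_zero two_ne_zero)

theorem IsJCStarAlgebra.isUnitalJCStarAlgebra_of_one_mem [CompleteSpace H]
    [Nontrivial (H →L[ℂ] H)] {A : Submodule ℂ (H →L[ℂ] H)} (hA : IsJCStarAlgebra A) (h1 : 1 ∈ A) :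
    IsUnitalJCStarAlgebra A :=
  ⟨hA, 1, h1, CStarRing.norm_one, fun a _ => jordanProd_one_left a⟩

theorem isJCStarAlgebra_map [CompleteSpace H] {E : Type*} [CStarAlgebra E]
    (π : E →⋆ₐ[ℂ] (H →L[ℂ] H)) (hπ : Function.Injective π) {S : Submodule ℂ E}
    (hS : IsClosed (S : Set E)) (hmul : ∀ a ∈ S, ∀ b ∈ S, a * b + b * a ∈ S)
    (hstar : ∀ a ∈ S, star a ∈ S) : IsJCStarAlgebra (S.map π.toAlgHom.toLinearMap) where
  isClosed := (NonUnitalStarAlgHom.isometry π hπ).isClosedEmbedding.isClosedMap _ hS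
  jordanProd_mem := by
    rintro _ ⟨a, ha, rfl⟩ _ ⟨b, hb, rfl⟩
    exact ⟨(2⁻¹ : ℂ) • (a * b + b * a), S.smul_mem _ (hmul a ha b hb), by simp [jordanProd]⟩
  star_mem := by
    rintro _ ⟨a, ha, rfl⟩
    exact ⟨star a, hstar a ha, map_star π a⟩

variable {A : Submodule ℂ (H →L[ℂ] H)} {B : Submodule ℂ (K →L[ℂ] K)}

theorem IsJordanIso.map_one {T : A ≃ₗ[ℂ] B} (hT : IsJordanIso T) (hA : 1 ∈ A) (hB : 1 ∈ B) :
    (T ⟨1, hA⟩ : K →L[ℂ] K) = 1 := by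
  obtain ⟨b, hb⟩ := T.surjective ⟨1, hB⟩
  have h : (1 : K →L[ℂ] K) = jordanProd (T ⟨1, hA⟩ : K →L[ℂ] K) 1 := by
    simpa only [hb] using hT ⟨1, hA⟩ b b (jordanProd_one_left _).symm
  rw [h, jordanProd_comm, jordanProd_one_left]

end JordanProduct

section AnticommutingInvolutions

/-- The subspace `S` contains two anticommuting square roots of `1`. Among subspaces of `B(H)`
containing `1`, this is a Jordan isomorphism invariant. -/
def HasAnticommutingInvolutions {E : Type*} [Ring E] [Module ℂ E] (S : Submodule ℂ E) : Prop :=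
  ∃ p ∈ S, ∃ q ∈ S, p * p = 1 ∧ q * q = 1 ∧ p * q + q * p = 0

theorem JordanIsomorphic.hasAnticommutingInvolutions {H K : Type*}
    [NormedAddCommGroup H] [InnerProductSpace ℂ H] [NormedAddCommGroup K] [InnerProductSpace ℂ K]
    {A : Submodule ℂ (H →L[ℂ] H)} {B : Submodule ℂ (K →L[ℂ] K)}
    (h : JordanIsomorphic A B) (h1A : 1 ∈ A) (h1B : 1 ∈ B) (hA : HasAnticommutingInvolutions A) :
    HasAnticommutingInvolutions B := by
  obtain ⟨T, hT⟩ := h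
  obtain ⟨p, hp, q, hq, hpp, hqq, hpq⟩ := hA
  have map_involution {r : H →L[ℂ] H} (hr : r ∈ A) (hrr : r * r = 1) :
      (T ⟨r, hr⟩ : K →L[ℂ] K) * T ⟨r, hr⟩ = 1 := by
    rw [← jordanProd_self, ← hT _ _ ⟨1, h1A⟩ (by rw [jordanProd_self, hrr]), hT.map_one h1A h1B]
  refine ⟨T ⟨p, hp⟩, (T _).2, T ⟨q, hq⟩, (T _).2, map_involution hp hpp, map_involution hq hqq, ?_⟩
  rw [← jordanProd_eq_zero_iff,
    ← hT _ _ 0 (jordanProd_eq_zero_iff.mpr hpq).symm, T.map_zero, Submodule.coe_zero]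

theorem hasAnticommutingInvolutions_map_iff {E F : Type*} [Ring E] [Algebra ℂ E] [Ring F]
    [Algebra ℂ F] (π : E →ₐ[ℂ] F) (hπ : Function.Injective π) (S : Submodule ℂ E) :
    HasAnticommutingInvolutions (S.map π.toLinearMap) ↔ HasAnticommutingInvolutions S := by
  simp only [HasAnticommutingInvolutions, Submodule.mem_map, exists_exists_and_eq_and,
    AlgHom.toLinearMap_apply, ← map_mul, ← map_add, map_eq_one_iff π hπ, map_eq_zero_iff π hπ]

end AnticommutingInvolutions

section RowsAndColumns

variable {E : Type*} [NonUnitalCStarAlgebra E]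
  {ι : Type*} [Fintype ι] [DecidableEq ι]

/-- The embedding `a ↦ a ⊗ e_{jj}` of a C⋆-algebra as a diagonal corner of its matrices. -/
def singleStarAlgHom (E : Type*) [NonUnitalCStarAlgebra E] (j : ι) :
    E →⋆ₙₐ[ℂ] CStarMatrix ι ι E where
  toFun a := CStarMatrix.ofMatrix (Matrix.single j j a)
  map_smul' c a := (Matrix.smul_single c j j a).symm
  map_zero' := Matrix.single_zero j j
  map_add' a b := Matrix.single_add j j a b
  map_mul' a b := (Matrix.single_mul_single_same (c := a) j j j b).symm
  map_star' a := (Matrix.conjTranspose_single j j a).symm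

theorem singleStarAlgHom_injective (j : ι) : Function.Injective (singleStarAlgHom E j) := by
  intro a b h
  have h' : Matrix.single j j a = Matrix.single j j b := h
  simpa using congrFun (congrFun h' j) j

variable [PartialOrder E] [StarOrderedRing E]

theorem norm_ofMatrix_single (j : ι) (a : E) :
    ‖CStarMatrix.ofMatrix (Matrix.single j j a)‖ = ‖a‖ :=
  NonUnitalStarAlgHom.norm_map (singleStarAlgHom E j) (singleStarAlgHom_injective j) a

theorem norm_ofMatrix_updateCol_mul_self (j : ι) (v : ι → E) :
    ‖CStarMatrix.ofMatrix ((0 : Matrix ι ι E).updateCol j v)‖ *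
        ‖CStarMatrix.ofMatrix ((0 : Matrix ι ι E).updateCol j v)‖ =
      ‖∑ i, star (v i) * v i‖ := by
  rw [← CStarRing.norm_star_mul_self, ← norm_ofMatrix_single j (∑ i, star (v i) * v i)]
  congr 1
  ext k l
  by_cases hk : k = j <;> by_cases hl : l = j <;>
    simp [CStarMatrix.mul_apply, CStarMatrix.star_apply, eq_comm (a := j), hk, hl]

theorem norm_ofMatrix_updateRow_mul_self (j : ι) (v : ι → E) :
    ‖CStarMatrix.ofMatrix ((0 : Matrix ι ι E).updateRow j v)‖ *
        ‖CStarMatrix.ofMatrix ((0 : Matrix ι ι E).updateRow j v)‖ =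
      ‖∑ i, v i * star (v i)‖ := by
  have h : CStarMatrix.ofMatrix ((0 : Matrix ι ι E).updateRow j v) =
      star (CStarMatrix.ofMatrix ((0 : Matrix ι ι E).updateCol j (star v))) := by
    refine Eq.trans ?_ (Matrix.updateRow_conjTranspose)
    rw [Matrix.conjTranspose_zero, star_star]
    rfl
  rw [h, norm_star, norm_ofMatrix_updateCol_mul_self]
  simp only [Pi.star_apply, star_star]

end RowsAndColumns

section RowColumnSymmetric

variable {H K : Type*} [NormedAddCommGroup H] [InnerProductSpace ℂ H] [CompleteSpace H]
  [NormedAddCommGroup K] [InnerProductSpace ℂ K] [CompleteSpace K]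
  {A : Submodule ℂ (H →L[ℂ] H)} {B : Submodule ℂ (K →L[ℂ] K)} {T : A → (K →L[ℂ] K)}

theorem IsCompletelyIsometric.norm_sum_star_mul_self (hT : IsCompletelyIsometric A T)
    (h0 : T 0 = 0) {m : ℕ} (x : Fin m → A) :
    ‖∑ i, star (T (x i)) * T (x i)‖ = ‖∑ i, star (x i : H →L[ℂ] H) * x i‖ := by
  cases m with
  | zero => simp
  | succ m =>
    have h := hT _ ((0 : Matrix _ _ A).updateCol 0 x)
    rw [Matrix.map_updateCol, Matrix.map_updateCol, Matrix.map_zero _ h0,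
      Matrix.map_zero _ rfl] at h
    simpa only [← norm_ofMatrix_updateCol_mul_self (0 : Fin (m + 1))] using! congrArg₂ (· * ·) h h

theorem IsCompletelyIsometric.norm_sum_mul_star_self (hT : IsCompletelyIsometric A T)
    (h0 : T 0 = 0) {m : ℕ} (x : Fin m → A) :
    ‖∑ i, T (x i) * star (T (x i))‖ = ‖∑ i, (x i : H →L[ℂ] H) * star (x i : H →L[ℂ] H)‖ := by
  cases m with
  | zero => simp
  | succ m =>
    have h := hT _ ((0 : Matrix _ _ A).updateRow 0 x)
    rw [Matrix.map_updateRow, Matrix.map_updateRow, Matrix.map_zero _ h0,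
      Matrix.map_zero _ rfl] at h
    simpa only [← norm_ofMatrix_updateRow_mul_self (0 : Fin (m + 1))] using! congrArg₂ (· * ·) h h

/-- Every finite family in `A` has the same norm as a row and as a column, i.e.
`‖∑ xᵢ* xᵢ‖ = ‖∑ xᵢ xᵢ*‖`. This is a linear complete isometry invariant. -/
def IsRowColumnSymmetric (A : Submodule ℂ (H →L[ℂ] H)) : Prop :=
  ∀ (m : ℕ) (x : Fin m → A), ‖∑ i, star (x i : H →L[ℂ] H) * x i‖ =
    ‖∑ i, (x i : H →L[ℂ] H) * star (x i : H →L[ℂ] H)‖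

theorem LinearlyCompletelyIsometric.isRowColumnSymmetric (h : LinearlyCompletelyIsometric A B)
    (hB : IsRowColumnSymmetric B) : IsRowColumnSymmetric A := by
  obtain ⟨T, hT⟩ := h
  have h0 : (T 0 : K →L[ℂ] K) = 0 := by rw [T.map_zero, Submodule.coe_zero]
  intro m x
  rw [← hT.norm_sum_star_mul_self h0, ← hT.norm_sum_mul_star_self h0]
  exact hB m fun i => T (x i)

theorem isRowColumnSymmetric_of_forall_eq_op
    (τ : (H →L[ℂ] H) →⋆ₙₐ[ℂ] (H →L[ℂ] H)ᵐᵒᵖ) (hτ : Function.Injective τ)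
    (hA : ∀ a ∈ A, τ a = MulOpposite.op a) : IsRowColumnSymmetric A := by
  intro m x
  rw [← NonUnitalStarAlgHom.norm_map τ hτ, ← MulOpposite.norm_op (∑ i, _)]
  congr 1
  simp [hA, map_star τ, MulOpposite.op_star, Finset.op_sum]

end RowColumnSymmetric

section MatrixExample

variable (n : ℕ)

theorem isUnitalJCStarAlgebra_matrixAlgebra (hn : n ≠ 0) :
    IsUnitalJCStarAlgebra (matrixAlgebra n) := by
  have : NeZero n := ⟨hn⟩
  refine IsJCStarAlgebra.isUnitalJCStarAlgebra_of_one_mem ?_ Submodule.mem_top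
  exact ⟨isClosed_univ, fun _ _ _ _ => Submodule.mem_top, fun _ _ => Submodule.mem_top⟩

theorem diagTranspose_toEuclideanCLM (M : Matrix (Fin n) (Fin n) ℂ) :
    diagTranspose n (Matrix.toEuclideanCLM (𝕜 := ℂ) M) =
      Matrix.toEuclideanCLM (𝕜 := ℂ) (Matrix.fromBlocks M 0 0 M.transpose) := by
  simp [diagTranspose]

theorem exists_toEuclideanCLM_eq {ι : Type*} [Fintype ι] [DecidableEq ι]
    (x : EuclideanSpace ℂ ι →L[ℂ] EuclideanSpace ℂ ι) :
    ∃ M, Matrix.toEuclideanCLM (𝕜 := ℂ) M = x :=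
  ⟨_, StarAlgEquiv.apply_symm_apply _ x⟩

theorem diagTranspose_injective : Function.Injective (diagTranspose n) := by
  intro x y h
  obtain ⟨M, rfl⟩ := exists_toEuclideanCLM_eq x
  obtain ⟨N, rfl⟩ := exists_toEuclideanCLM_eq y
  rw [diagTranspose_toEuclideanCLM, diagTranspose_toEuclideanCLM] at h
  rw [(Matrix.fromBlocks_inj.mp ((Matrix.toEuclideanCLM (𝕜 := ℂ)).injective h)).1]

theorem diagTranspose_one : diagTranspose n 1 = 1 := by
  rw [← map_one (Matrix.toEuclideanCLM (n := Fin n) (𝕜 := ℂ)), diagTranspose_toEuclideanCLM,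
    Matrix.transpose_one, Matrix.fromBlocks_one, map_one]

theorem diagTranspose_star (x : EuclideanSpace ℂ (Fin n) →L[ℂ] EuclideanSpace ℂ (Fin n)) :
    diagTranspose n (star x) = star (diagTranspose n x) := by
  obtain ⟨M, rfl⟩ := exists_toEuclideanCLM_eq x
  rw [← map_star, diagTranspose_toEuclideanCLM, diagTranspose_toEuclideanCLM, ← map_star]
  simp only [Matrix.star_eq_conjTranspose, Matrix.fromBlocks_conjTranspose,
    Matrix.conjTranspose_zero]
  rfl

theorem diagTranspose_jordanProd
    (x y : EuclideanSpace ℂ (Fin n) →L[ℂ] EuclideanSpace ℂ (Fin n)) :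
    diagTranspose n (jordanProd x y) = jordanProd (diagTranspose n x) (diagTranspose n y) := by
  obtain ⟨M, rfl⟩ := exists_toEuclideanCLM_eq x
  obtain ⟨N, rfl⟩ := exists_toEuclideanCLM_eq y
  simp only [jordanProd, diagTranspose_toEuclideanCLM, ← map_mul, ← map_add, map_smul]
  simp [Matrix.fromBlocks_multiply, Matrix.fromBlocks_add, Matrix.transpose_mul, add_comm]

theorem isUnitalJCStarAlgebra_diagTransposeAlgebra (hn : n ≠ 0) :
    IsUnitalJCStarAlgebra (diagTransposeAlgebra n) := by
  have : NeZero n := ⟨hn⟩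
  refine IsJCStarAlgebra.isUnitalJCStarAlgebra_of_one_mem ?_ ⟨1, diagTranspose_one n⟩
  refine ⟨Submodule.closed_of_finiteDimensional _, ?_, ?_⟩
  · rintro _ ⟨x, rfl⟩ _ ⟨y, rfl⟩
    exact ⟨_, diagTranspose_jordanProd n x y⟩
  · rintro _ ⟨x, rfl⟩
    exact ⟨_, diagTranspose_star n x⟩

/-- The map `x ↦ (x, xᵀ)` of `M_n` onto its range. -/
noncomputable def diagTransposeEquiv : matrixAlgebra n ≃ₗ[ℂ] diagTransposeAlgebra n :=
  Submodule.topEquiv.trans (LinearEquiv.ofInjective _ (diagTranspose_injective n))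

theorem diagTransposeEquiv_apply (x : matrixAlgebra n) :
    (diagTransposeEquiv n x : EuclideanSpace ℂ (Fin n ⊕ Fin n) →L[ℂ] _) = diagTranspose n x := rfl

theorem isJordanStarIso_diagTransposeEquiv : IsJordanStarIso (diagTransposeEquiv n) := by
  refine ⟨fun a b c h => ?_, fun a c h => ?_⟩
  · simp only [diagTransposeEquiv_apply, h, diagTranspose_jordanProd]
  · simp only [diagTransposeEquiv_apply, h, diagTranspose_star]

/-- The `*`-antiautomorphism of `B(ℂ^ι ⊕ ℂ^ι)` given by transposing a matrix and exchanging the two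
summands. On block diagonal operators it is `(a, b) ↦ (bᵀ, aᵀ)`. -/
noncomputable def swapTranspose (ι : Type*) [Fintype ι] [DecidableEq ι] :
    (EuclideanSpace ℂ (ι ⊕ ι) →L[ℂ] EuclideanSpace ℂ (ι ⊕ ι)) →⋆ₙₐ[ℂ]
      (EuclideanSpace ℂ (ι ⊕ ι) →L[ℂ] EuclideanSpace ℂ (ι ⊕ ι))ᵐᵒᵖ where
  toFun x := MulOpposite.op (Matrix.toEuclideanCLM (𝕜 := ℂ) (((Matrix.toEuclideanCLM (𝕜 := ℂ)).symm
    x).submatrix (Equiv.sumComm ι ι) (Equiv.sumComm ι ι)).transpose)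
  map_smul' c x := by
    simp [Matrix.submatrix_smul]
  map_zero' := by simp
  map_add' x y := by simp [Matrix.submatrix_add]
  map_mul' x y := by
    obtain ⟨M, rfl⟩ := exists_toEuclideanCLM_eq x
    obtain ⟨N, rfl⟩ := exists_toEuclideanCLM_eq y
    simp only [← map_mul, StarAlgEquiv.symm_apply_apply]
    rw [← MulOpposite.op_mul, ← map_mul, ← Matrix.transpose_mul, Matrix.submatrix_mul_equiv]
  map_star' x := by
    obtain ⟨M, rfl⟩ := exists_toEuclideanCLM_eq x
    rw [← map_star, ← MulOpposite.op_star]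
    simp only [StarAlgEquiv.symm_apply_apply]
    rw [← map_star]
    rfl

theorem swapTranspose_injective (ι : Type*) [Fintype ι] [DecidableEq ι] :
    Function.Injective (swapTranspose ι) := by
  intro x y h
  have h' := Matrix.transpose_injective
    ((Matrix.toEuclideanCLM (𝕜 := ℂ)).injective (MulOpposite.op_injective h))
  exact (Matrix.toEuclideanCLM (𝕜 := ℂ)).symm.injective
    ((Matrix.reindex (Equiv.sumComm ι ι).symm (Equiv.sumComm ι ι).symm).injective h')

theorem swapTranspose_diagTranspose
    (x : EuclideanSpace ℂ (Fin n) →L[ℂ] EuclideanSpace ℂ (Fin n)) :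
    swapTranspose (Fin n) (diagTranspose n x) = MulOpposite.op (diagTranspose n x) := by
  obtain ⟨M, rfl⟩ := exists_toEuclideanCLM_eq x
  rw [diagTranspose_toEuclideanCLM]
  refine congrArg (fun N => MulOpposite.op (Matrix.toEuclideanCLM (𝕜 := ℂ) N)) ?_
  rw [StarAlgEquiv.symm_apply_apply]
  simp only [Equiv.sumComm_apply, Matrix.fromBlocks_submatrix_sum_swap_sum_swap,
    Matrix.fromBlocks_transpose, Matrix.transpose_transpose, Matrix.transpose_zero]

theorem isRowColumnSymmetric_diagTransposeAlgebra :
    IsRowColumnSymmetric (diagTransposeAlgebra n) := by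
  refine isRowColumnSymmetric_of_forall_eq_op _ (swapTranspose_injective (Fin n)) ?_
  rintro _ ⟨x, rfl⟩
  exact swapTranspose_diagTranspose n x

/-- The matrix unit `e_{ij}` as an operator. -/
noncomputable def matrixUnit {ι : Type*} [Fintype ι] [DecidableEq ι] (i j : ι) :
    EuclideanSpace ℂ ι →L[ℂ] EuclideanSpace ℂ ι :=
  Matrix.toEuclideanCLM (𝕜 := ℂ) (Matrix.single i j 1)

section MatrixUnit

variable {ι : Type*} [Fintype ι] [DecidableEq ι]

theorem star_matrixUnit (i j : ι) : star (matrixUnit i j) = matrixUnit j i := by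
  rw [matrixUnit, ← map_star, Matrix.star_eq_conjTranspose, Matrix.conjTranspose_single, star_one,
    matrixUnit]

theorem matrixUnit_mul (i j k : ι) : matrixUnit i j * matrixUnit j k = matrixUnit i k := by
  rw [matrixUnit, matrixUnit, ← map_mul, Matrix.single_mul_single_same, one_mul, matrixUnit]

theorem norm_matrixUnit_self (i : ι) : ‖matrixUnit i i‖ = 1 := by
  rw [matrixUnit, ← Matrix.diagonal_single, ← Matrix.cstar_norm_def, Matrix.l2_opNorm_diagonal,
    Pi.norm_single, norm_one]

theorem sum_matrixUnit_self : ∑ i : ι, matrixUnit i i = 1 := by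
  simp only [matrixUnit, ← map_sum, Matrix.sum_single_one, map_one]

theorem norm_sum_star_mul_matrixUnit (j : ι) :
    ‖∑ i, star (matrixUnit i j) * matrixUnit i j‖ = Fintype.card ι := by
  simp only [star_matrixUnit, matrixUnit_mul, Finset.sum_const, Finset.card_univ]
  rw [RCLike.norm_nsmul ℂ, norm_matrixUnit_self, nsmul_eq_mul, mul_one]

theorem norm_sum_matrixUnit_mul_star (j : ι) :
    ‖∑ i, matrixUnit i j * star (matrixUnit i j)‖ = 1 := by
  have : Nonempty ι := ⟨j⟩
  simp only [star_matrixUnit, matrixUnit_mul, sum_matrixUnit_self, norm_one]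

end MatrixUnit

variable {n}

theorem transposeOp_matrixUnit (i j : Fin n) :
    transposeOp n (matrixUnit i j) = matrixUnit j i := by
  simp [transposeOp, matrixUnit]

theorem not_isRowColumnSymmetric_matrixAlgebra (hn : 2 ≤ n) :
    ¬ IsRowColumnSymmetric (matrixAlgebra n) := by
  intro h
  let j : Fin n := ⟨0, by lia⟩
  have h' := h n fun i => ⟨matrixUnit i j, Submodule.mem_top⟩
  rw [norm_sum_star_mul_matrixUnit, norm_sum_matrixUnit_mul_star, Fintype.card_fin,
    Nat.cast_eq_one] at h'
  lia

theorem not_linearlyCompletelyIsometric_matrixAlgebra_diagTransposeAlgebra (hn : 2 ≤ n) :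
    ¬ LinearlyCompletelyIsometric (matrixAlgebra n) (diagTransposeAlgebra n) := fun h =>
  not_isRowColumnSymmetric_matrixAlgebra hn
    (h.isRowColumnSymmetric (isRowColumnSymmetric_diagTransposeAlgebra n))

theorem not_isCompletelyIsometric_transposeOp (hn : 2 ≤ n) :
    ¬ IsCompletelyIsometric (matrixAlgebra n) (fun x => transposeOp n x) := by
  intro h
  let j : Fin n := ⟨0, by lia⟩
  have h' := h.norm_sum_star_mul_self (by simp [transposeOp])
    fun i => ⟨matrixUnit i j, Submodule.mem_top⟩
  have hrow := norm_sum_matrixUnit_mul_star j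
  rw [norm_sum_star_mul_matrixUnit, Fintype.card_fin] at h'
  simp only [transposeOp_matrixUnit, star_matrixUnit] at h' hrow
  rw [hrow, eq_comm, Nat.cast_eq_one] at h'
  lia

end MatrixExample

section PositiveFunctionals

open MeasureTheory
open scoped ComplexOrder

theorem map_nonneg_of_forall_map_star_mul_self_nonneg {R M F : Type*} [NonUnitalSemiring R]
    [StarRing R] [PartialOrder R] [StarOrderedRing R] [AddCommMonoid M] [PartialOrder M]
    [IsOrderedAddMonoid M] [FunLike F R M] [AddMonoidHomClass F R M] (g : F)
    (hg : ∀ a, 0 ≤ g (star a * a)) (x : R) (hx : 0 ≤ x) : 0 ≤ g x :=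
  (AddSubmonoid.closure_le (S := (AddSubmonoid.nonneg M).comap (g : R →+ M))).mpr
    (Set.range_subset_iff.mpr hg) (StarOrderedRing.nonneg_iff.mp hx)

theorem sum_map_star_mul_self_diag {R M F ι : Type*} [Fintype ι] [NonUnitalSemiring R]
    [StarRing R] [AddCommMonoid M] [FunLike F R M] [AddMonoidHomClass F R M] (g : F)
    (x : CStarMatrix ι ι R) :
    ∑ j, g ((star x * x) j j) = ∑ j, ∑ i, g (star (x i j) * x i j) := by
  simp only [CStarMatrix.mul_apply, CStarMatrix.star_apply, map_sum]

variable {E : Type*} [CStarAlgebra E] [PartialOrder E]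

/-- A positive functional is faithful if it vanishes on no nonzero element `a* a`. -/
def IsFaithfulFunctional (f : E →ₚ[ℂ] ℂ) : Prop :=
  ∀ a, f (star a * a) = 0 → a = 0

variable [StarOrderedRing E] {f : E →ₚ[ℂ] ℂ}

theorem IsFaithfulFunctional.injective_gnsStarAlgHom (hf : IsFaithfulFunctional f) :
    Function.Injective f.gnsStarAlgHom := by
  refine (injective_iff_map_eq_zero _).mpr fun a ha => hf a ?_
  have h : ((f.leftMulMapPreGNS a (f.toPreGNS 1) : f.PreGNS) : f.GNS) = 0 := by
    rw [← PositiveLinearMap.gnsNonUnitalStarAlgHom_apply_coe]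
    exact DFunLike.congr_fun ha _
  have hnorm : ‖f.leftMulMapPreGNS a (f.toPreGNS 1)‖ = 0 := by
    rw [← UniformSpace.Completion.norm_coe, h, norm_zero]
  have hsq := f.preGNS_norm_sq (f.leftMulMapPreGNS a (f.toPreGNS 1))
  rw [hnorm] at hsq
  simpa using hsq.symm

section Trace

variable {ι : Type*} [Fintype ι] [DecidableEq ι]

/-- The functional `f ∘ tr` on matrices over a C⋆-algebra. -/
noncomputable def traceFunctional (ι : Type*) [Fintype ι] [DecidableEq ι] (f : E →ₚ[ℂ] ℂ) :
    CStarMatrix ι ι E →ₚ[ℂ] ℂ :=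
  let g : CStarMatrix ι ι E →ₗ[ℂ] ℂ :=
    { toFun x := ∑ j, f (x j j)
      map_add' x y := by simp only [CStarMatrix.add_apply, map_add, Finset.sum_add_distrib]
      map_smul' c x := by
        simp only [CStarMatrix.smul_apply, map_smul, Finset.smul_sum, RingHom.id_apply] }
  PositiveLinearMap.mk₀ g <| map_nonneg_of_forall_map_star_mul_self_nonneg g fun x =>
    (Finset.sum_nonneg fun j _ => Finset.sum_nonneg fun i _ =>
      map_nonneg f (star_mul_self_nonneg (x i j))).trans_eq (sum_map_star_mul_self_diag f x).symm

theorem traceFunctional_apply (f : E →ₚ[ℂ] ℂ) (x : CStarMatrix ι ι E) :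
    traceFunctional ι f x = ∑ j, f (x j j) := rfl

theorem IsFaithfulFunctional.traceFunctional (hf : IsFaithfulFunctional f) :
    IsFaithfulFunctional (traceFunctional ι f) := by
  intro x hx
  have hnonneg (i j : ι) : 0 ≤ f (star (x i j) * x i j) := map_nonneg f (star_mul_self_nonneg _)
  rw [traceFunctional_apply, sum_map_star_mul_self_diag,
    Finset.sum_eq_zero_iff_of_nonneg fun j _ => Finset.sum_nonneg fun i _ => hnonneg i j] at hx
  ext i j
  exact hf _ ((Finset.sum_eq_zero_iff_of_nonneg fun i _ => hnonneg i j).mp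
    (hx j (Finset.mem_univ j)) i (Finset.mem_univ i))

end Trace

section Integral

variable {X : Type*} [TopologicalSpace X] [CompactSpace X] [MeasurableSpace X] [BorelSpace X]
  (μ : Measure X) [IsFiniteMeasure μ]

theorem integrable_continuousMap (a : C(X, ℂ)) : Integrable a μ :=
  a.continuous.integrable_of_hasCompactSupport (HasCompactSupport.of_compactSpace _)

/-- Integration against a finite measure, as a positive functional on `C(X)`. -/
noncomputable def integralFunctional : C(X, ℂ) →ₚ[ℂ] ℂ :=
  PositiveLinearMap.mk₀
    { toFun a := ∫ t, a t ∂μ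
      map_add' a b := integral_add (integrable_continuousMap μ a) (integrable_continuousMap μ b)
      map_smul' c a := integral_smul c a }
    fun _ ha => integral_nonneg ha

theorem integralFunctional_apply (a : C(X, ℂ)) : integralFunctional μ a = ∫ t, a t ∂μ := rfl

theorem isFaithfulFunctional_integralFunctional [μ.IsOpenPosMeasure] :
    IsFaithfulFunctional (integralFunctional μ) := by
  intro a ha
  by_contra hne
  obtain ⟨t, ht⟩ := DFunLike.ne_iff.mp hne
  have hpos : 0 < ∫ t, ‖a t‖ ^ 2 ∂μ :=
    Continuous.integral_pos_of_hasCompactSupport_nonneg_nonzero (by fun_prop)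
      (HasCompactSupport.of_compactSpace _) (fun t => by positivity)
      (pow_ne_zero 2 (norm_ne_zero_iff.mpr ht))
  rw [integralFunctional_apply] at ha
  have hsq (t : X) : (star a * a) t = ((‖a t‖ ^ 2 : ℝ) : ℂ) := by simp [Complex.conj_mul']
  simp only [hsq, integral_complex_ofReal, Complex.ofReal_eq_zero] at ha
  exact hpos.ne' ha

end Integral

end PositiveFunctionals

section Isotope

theorem ofMatrix_diagonal_mem_unitary {E ι : Type*} [Ring E] [StarRing E] [Fintype ι]
    [DecidableEq ι] {u : ι → E} (hu : ∀ i, u i ∈ unitary E) :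
    CStarMatrix.ofMatrix (Matrix.diagonal u) ∈ unitary (CStarMatrix ι ι E) := by
  have hstar : star (CStarMatrix.ofMatrix (Matrix.diagonal u)) =
      CStarMatrix.ofMatrix (Matrix.diagonal (star u)) := Matrix.diagonal_conjTranspose u
  rw [Unitary.mem_iff, hstar]
  constructor
  · refine (Matrix.diagonal_mul_diagonal _ _).trans ?_
    simp only [Pi.star_apply, Unitary.star_mul_self_of_mem (hu _)]
    exact Matrix.diagonal_one
  · refine (Matrix.diagonal_mul_diagonal _ _).trans ?_
    simp only [Pi.star_apply, Unitary.mul_star_self_of_mem (hu _)]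
    exact Matrix.diagonal_one

variable {H : Type*} [NormedAddCommGroup H] [InnerProductSpace ℂ H] [CompleteSpace H]

theorem linearlyCompletelyIsometric_map_mulRight (A : Submodule ℂ (H →L[ℂ] H))
    {u : H →L[ℂ] H} (hu : u ∈ unitary (H →L[ℂ] H)) :
    LinearlyCompletelyIsometric A (A.map (LinearMap.mulRight ℂ u)) := by
  have hinj : Function.Injective (LinearMap.mulRight ℂ u) :=
    (Unitary.isUnit_coe (U := ⟨u, hu⟩)).mul_left_injective
  refine ⟨Submodule.equivMapOfInjective _ hinj A, fun m x => ?_⟩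
  refine Eq.trans ?_ (CStarRing.norm_mul_mem_unitary
    (CStarMatrix.ofMatrix (x.map (fun a : A => (a : H →L[ℂ] H))))
    (ofMatrix_diagonal_mem_unitary fun _ => hu))
  congr 1
  ext1 i j
  exact (Matrix.mul_diagonal (fun _ => u) (x.map (fun a : A => (a : H →L[ℂ] H))) i j).symm

theorem linearlyCompletelyIsometric_map_map_mulRight {E : Type*} [Ring E]
    [StarRing E] [Algebra ℂ E]
    (π : E →⋆ₐ[ℂ] (H →L[ℂ] H)) (S : Submodule ℂ E) {u : E} (hu : u ∈ unitary E) :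
    LinearlyCompletelyIsometric (S.map π.toAlgHom.toLinearMap)
      ((S.map (LinearMap.mulRight ℂ u)).map π.toAlgHom.toLinearMap) := by
  have hcomm : π.toAlgHom.toLinearMap ∘ₗ LinearMap.mulRight ℂ u =
      LinearMap.mulRight ℂ (π u) ∘ₗ π.toAlgHom.toLinearMap :=
    LinearMap.ext fun x => map_mul π x u
  rw [← Submodule.map_comp, hcomm, Submodule.map_comp]
  exact linearlyCompletelyIsometric_map_mulRight _ (Unitary.map_mem π hu)

end Isotope

section TwistedSymmetric

section Unitary

variable {R : Type*} [CommRing R] [StarRing R] {w : R}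

/-- Right multiplication by this unitary turns `x₀₁ = v x₁₀` into `x₀₁ = v w x₁₀`. -/
def twistUnitary (w : R) : CStarMatrix (Fin 2) (Fin 2) R :=
  CStarMatrix.ofMatrix (Matrix.diagonal ![star w, 1])

theorem twistUnitary_mem_unitary (hw : w ∈ unitary R) :
    twistUnitary w ∈ unitary (CStarMatrix (Fin 2) (Fin 2) R) :=
  ofMatrix_diagonal_mem_unitary (Fin.forall_fin_two.mpr ⟨Unitary.star_mem hw, one_mem _⟩)

end Unitary

section Algebra

variable {R : Type*} [CommRing R] [Algebra ℂ R] {w : R} {x y : CStarMatrix (Fin 2) (Fin 2) R}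

/-- The `2 × 2` matrices `x` over `R` with `x₀₁ = w x₁₀`; for `w = 1` these are the symmetric
matrices. -/
def twistedSymmetric (w : R) : Submodule ℂ (CStarMatrix (Fin 2) (Fin 2) R) where
  carrier := {x | x 0 1 = w * x 1 0}
  add_mem' {x y} hx hy := by
    simp only [Set.mem_ofPred_eq, CStarMatrix.add_apply] at *
    rw [hx, hy, mul_add]
  zero_mem' := by simp
  smul_mem' c x hx := by
    simp only [Set.mem_ofPred_eq, CStarMatrix.smul_apply] at *
    rw [hx, mul_smul_comm]

theorem mem_twistedSymmetric : x ∈ twistedSymmetric w ↔ x 0 1 = w * x 1 0 := Iff.rfl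

theorem one_mem_twistedSymmetric (w : R) : 1 ∈ twistedSymmetric w := by
  simp [mem_twistedSymmetric]

theorem mul_add_mul_mem_twistedSymmetric (hx : x ∈ twistedSymmetric w)
    (hy : y ∈ twistedSymmetric w) : x * y + y * x ∈ twistedSymmetric w := by
  rw [mem_twistedSymmetric] at *
  simp only [CStarMatrix.add_apply, CStarMatrix.mul_apply, Fin.sum_univ_two, hx, hy]
  ring

theorem hasAnticommutingInvolutions_twistedSymmetric_one :
    HasAnticommutingInvolutions (twistedSymmetric (1 : R)) := by
  refine ⟨CStarMatrix.ofMatrix !![1, 0; 0, -1], by simp [mem_twistedSymmetric],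
    CStarMatrix.ofMatrix !![0, 1; 1, 0], by simp [mem_twistedSymmetric], ?_, ?_, ?_⟩ <;>
  ext i j <;> fin_cases i <;> fin_cases j <;> simp [CStarMatrix.mul_apply]

theorem isSquare_of_hasAnticommutingInvolutions
    (h : HasAnticommutingInvolutions (twistedSymmetric w)) : IsSquare w := by
  obtain ⟨p, hp, q, hq, hpp, hqq, hpq⟩ := h
  rw [mem_twistedSymmetric] at hp hq
  have h₁ : (p * p) 0 0 = 1 := by rw [hpp, CStarMatrix.one_apply_eq]
  have h₂ : (q * q) 0 0 = 1 := by rw [hqq, CStarMatrix.one_apply_eq]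
  have h₃ : (p * q + q * p) 0 0 = 0 := by rw [hpq, CStarMatrix.zero_apply]
  simp only [CStarMatrix.add_apply, CStarMatrix.mul_apply, Fin.sum_univ_two, hp, hq] at h₁ h₂ h₃
  generalize p 0 0 = a, p 1 0 = b, q 0 0 = c, q 1 0 = d at h₁ h₂ h₃
  have horth : a * c + w * b * d = 0 := by
    refine (smul_eq_zero_iff_right (two_ne_zero (α := ℂ))).mp ?_
    rw [two_smul]
    linear_combination h₃
  -- Brahmagupta's identity
  have hdisc : w * (a * d - b * c) ^ 2 = 1 := calc
    w * (a * d - b * c) ^ 2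
      = (a * a + w * b * b) * (c * c + w * d * d) - (a * c + w * b * d) ^ 2 := by ring
    _ = 1 := by rw [h₁, h₂, horth]; ring
  exact ⟨w * (a * d - b * c), by linear_combination -w * hdisc⟩

variable {H : Type*} [NormedAddCommGroup H] [InnerProductSpace ℂ H]

theorem not_jordanIsomorphic_map_twistedSymmetric
    (π : CStarMatrix (Fin 2) (Fin 2) R →ₐ[ℂ] (H →L[ℂ] H)) (hπ : Function.Injective π)
    (hw : ¬ IsSquare w) :
    ¬ JordanIsomorphic ((twistedSymmetric 1).map π.toLinearMap)
      ((twistedSymmetric w).map π.toLinearMap) := by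
  intro h
  refine hw (isSquare_of_hasAnticommutingInvolutions ?_)
  rw [← hasAnticommutingInvolutions_map_iff π hπ]
  refine h.hasAnticommutingInvolutions ⟨1, one_mem_twistedSymmetric 1, map_one π⟩
    ⟨1, one_mem_twistedSymmetric w, map_one π⟩ ?_
  rw [hasAnticommutingInvolutions_map_iff π hπ]
  exact hasAnticommutingInvolutions_twistedSymmetric_one

variable [StarRing R]

theorem star_mem_twistedSymmetric (hw : w ∈ unitary R) (hx : x ∈ twistedSymmetric w) :
    star x ∈ twistedSymmetric w := by
  rw [mem_twistedSymmetric] at *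
  rw [CStarMatrix.star_apply, CStarMatrix.star_apply, hx, star_mul', ← mul_assoc,
    Unitary.mul_star_self_of_mem hw, one_mul]

theorem map_mulRight_twistUnitary (v : R) (hw : w ∈ unitary R) :
    (twistedSymmetric v).map (LinearMap.mulRight ℂ (twistUnitary w)) =
      twistedSymmetric (v * w) := by
  apply le_antisymm
  · rintro _ ⟨x, hx, rfl⟩
    have hx' : x 0 1 = v * x 1 0 := hx
    rw [mem_twistedSymmetric, LinearMap.mulRight_apply]
    simp only [twistUnitary, CStarMatrix.mul_apply, CStarMatrix.ofMatrix_apply, Fin.sum_univ_two,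
      Matrix.diagonal_apply, Matrix.cons_val_zero, Matrix.cons_val_one, hx', if_true, if_false,
      zero_ne_one, one_ne_zero]
    linear_combination -v * x 1 0 * Unitary.mul_star_self_of_mem hw
  · intro x hx
    rw [mem_twistedSymmetric] at hx
    refine ⟨x * star (twistUnitary w), ?_, ?_⟩
    · change (x * star (twistUnitary w)) 0 1 = v * (x * star (twistUnitary w)) 1 0
      simp only [twistUnitary, CStarMatrix.mul_apply, CStarMatrix.star_apply,
        CStarMatrix.ofMatrix_apply, Fin.sum_univ_two, Matrix.diagonal_apply, Matrix.cons_val_zero,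
        Matrix.cons_val_one, hx, if_true, if_false, zero_ne_one, one_ne_zero, star_star, star_one,
        star_zero]
      ring
    · rw [LinearMap.mulRight_apply, mul_assoc,
        Unitary.star_mul_self_of_mem (twistUnitary_mem_unitary hw), mul_one]

theorem linearlyCompletelyIsometric_map_twistedSymmetric [CompleteSpace H]
    (π : CStarMatrix (Fin 2) (Fin 2) R →⋆ₐ[ℂ] (H →L[ℂ] H)) (hw : w ∈ unitary R) :
    LinearlyCompletelyIsometric ((twistedSymmetric 1).map π.toAlgHom.toLinearMap)
      ((twistedSymmetric w).map π.toAlgHom.toLinearMap) := by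
  have h := linearlyCompletelyIsometric_map_map_mulRight π (twistedSymmetric 1)
    (twistUnitary_mem_unitary hw)
  rwa [map_mulRight_twistUnitary 1 hw, one_mul] at h

end Algebra

variable {R : Type*} [CommCStarAlgebra R] {w : R}

theorem isClosed_twistedSymmetric (w : R) :
    IsClosed (twistedSymmetric w : Set (CStarMatrix (Fin 2) (Fin 2) R)) := by
  have h (i j : Fin 2) : Continuous fun x : CStarMatrix (Fin 2) (Fin 2) R => x i j :=
    continuous_apply_apply (ρ := fun _ _ => R) i j
  exact isClosed_eq (h 0 1) (continuous_const.mul (h 1 0))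

theorem isUnitalJCStarAlgebra_map_twistedSymmetric [PartialOrder R] [StarOrderedRing R]
    [Nontrivial R] {H : Type*} [NormedAddCommGroup H] [InnerProductSpace ℂ H] [CompleteSpace H]
    {π : CStarMatrix (Fin 2) (Fin 2) R →⋆ₐ[ℂ] (H →L[ℂ] H)} (hπ : Function.Injective π)
    (hw : w ∈ unitary R) :
    IsUnitalJCStarAlgebra ((twistedSymmetric w).map π.toAlgHom.toLinearMap) := by
  have := hπ.nontrivial
  refine IsJCStarAlgebra.isUnitalJCStarAlgebra_of_one_mem ?_
    ⟨1, one_mem_twistedSymmetric w, map_one π⟩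
  exact isJCStarAlgebra_map π hπ (isClosed_twistedSymmetric w)
    (fun _ ha _ hb => mul_add_mul_mem_twistedSymmetric ha hb)
    (fun _ ha => star_mem_twistedSymmetric hw ha)

end TwistedSymmetric

section Circle

theorem fourier_mem_unitary (T : ℝ) (n : ℤ) : fourier n ∈ unitary C(AddCircle T, ℂ) := by
  refine Unitary.mem_iff_self_mul_star.mpr ?_
  ext t
  simp [Complex.mul_conj', Circle.norm_coe]

variable {T : ℝ} [hT : Fact (0 < T)]

theorem not_isSquare_fourier_one : ¬ IsSquare (fourier 1 : C(AddCircle T, ℂ)) := by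
  rintro ⟨y, hy⟩
  have hyy (x : AddCircle T) : y x * y x = fourier 1 x := (DFunLike.congr_fun hy x).symm
  have hne (x : AddCircle T) : y x ≠ 0 := fun h => by
    have hx := hyy x
    rw [h, mul_zero, fourier_apply] at hx
    exact Circle.coe_ne_zero _ hx.symm
  let s : AddCircle T := ((T / 2 / (1 : ℤ) : ℝ) : AddCircle T)
  have hss : s + s = 0 := by
    rw [← AddCircle.coe_add, ← AddCircle.coe_period T]
    congr 1
    push_cast
    ring
  obtain ⟨c, hc, hys⟩ : ∃ c : ℂ, c * c = -1 ∧ ∀ x, y (x + s) = c * y x := by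
    have hsq : Set.EqOn ((fun x => y (x + s)) ^ 2) ((fun x => Complex.I * y x) ^ 2) Set.univ := by
      intro x _
      simp only [Pi.pow_apply, mul_pow, Complex.I_sq, sq (y _), hyy]
      rw [fourier_add_half_inv_index one_ne_zero hT.out, neg_one_mul]
    rcases isPreconnected_univ.eq_or_eq_neg_of_sq_eq (by fun_prop) (by fun_prop) hsq
      (fun {x} _ => mul_ne_zero Complex.I_ne_zero (hne x)) with h | h
    · exact ⟨Complex.I, Complex.I_mul_I, fun x => h (Set.mem_univ x)⟩
    · exact ⟨-Complex.I, by simp, fun x => (h (Set.mem_univ x)).trans (neg_mul _ _).symm⟩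
  have hy0 : y 0 = -y 0 := calc
    y 0 = y (0 + s + s) := by rw [add_assoc, hss, add_zero]
    _ = -y 0 := by rw [hys, hys, ← mul_assoc, hc, neg_one_mul]
  exact hne 0 (self_eq_neg.mp hy0)

end Circle

open scoped ComplexOrder in
theorem exists_linearlyCompletelyIsometric_not_jordanIsomorphic :
    ∃ (H : Type) (_ : NormedAddCommGroup H) (_ : InnerProductSpace ℂ H) (_ : CompleteSpace H)
      (A B : Submodule ℂ (H →L[ℂ] H)), IsUnitalJCStarAlgebra A ∧ IsUnitalJCStarAlgebra B ∧
        LinearlyCompletelyIsometric A B ∧ ¬ JordanIsomorphic A B := by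
  let f := traceFunctional (Fin 2) (integralFunctional (AddCircle.haarAddCircle (T := 1)))
  have hπ : Function.Injective f.gnsStarAlgHom :=
    (isFaithfulFunctional_integralFunctional _).traceFunctional.injective_gnsStarAlgHom
  exact ⟨f.GNS, inferInstance, inferInstance, inferInstance, _, _,
    isUnitalJCStarAlgebra_map_twistedSymmetric hπ (one_mem _),
    isUnitalJCStarAlgebra_map_twistedSymmetric hπ (fourier_mem_unitary 1 1),
    linearlyCompletelyIsometric_map_twistedSymmetric _ (fourier_mem_unitary 1 1),
    not_jordanIsomorphic_map_twistedSymmetric _ hπ not_isSquare_fourier_one⟩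

theorem proposition4p3 :
    -- linearly completely isometric, but not Jordan isomorphic
    (∃ (H K : Type) (_ : NormedAddCommGroup H) (_ : InnerProductSpace ℂ H) (_ : CompleteSpace H)
      (_ : NormedAddCommGroup K) (_ : InnerProductSpace ℂ K) (_ : CompleteSpace K)
      (A : Submodule ℂ (H →L[ℂ] H)) (B : Submodule ℂ (K →L[ℂ] K)),
      IsUnitalJCStarAlgebra A ∧ IsUnitalJCStarAlgebra B ∧
        LinearlyCompletelyIsometric A B ∧ ¬ JordanIsomorphic A B) ∧
    -- Jordan `*`-isomorphic, but not linearly completely isometric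
    (∃ (H K : Type) (_ : NormedAddCommGroup H) (_ : InnerProductSpace ℂ H) (_ : CompleteSpace H)
      (_ : NormedAddCommGroup K) (_ : InnerProductSpace ℂ K) (_ : CompleteSpace K)
      (A : Submodule ℂ (H →L[ℂ] H)) (B : Submodule ℂ (K →L[ℂ] K)),
      IsUnitalJCStarAlgebra A ∧ IsUnitalJCStarAlgebra B ∧
        JordanStarIsomorphic A B ∧ ¬ LinearlyCompletelyIsometric A B) ∧
    -- the example `M_n` and `{(x, xᵀ)} ⊆ M_n ⊕ M_n`, and the transpose
    (∀ n : ℕ, 2 ≤ n →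
      IsUnitalJCStarAlgebra (matrixAlgebra n) ∧
      IsUnitalJCStarAlgebra (diagTransposeAlgebra n) ∧
      (∃ T : matrixAlgebra n ≃ₗ[ℂ] diagTransposeAlgebra n,
        IsJordanStarIso T ∧ ∀ x : matrixAlgebra n,
          (T x : EuclideanSpace ℂ (Fin n ⊕ Fin n) →L[ℂ] EuclideanSpace ℂ (Fin n ⊕ Fin n)) =
            diagTranspose n x) ∧
      ¬ LinearlyCompletelyIsometric (matrixAlgebra n) (diagTransposeAlgebra n) ∧
      ¬ IsCompletelyIsometric (matrixAlgebra n) (fun x => transposeOp n x)) := by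
  refine ⟨?_, ?_, fun n hn => ⟨isUnitalJCStarAlgebra_matrixAlgebra n (by lia),
    isUnitalJCStarAlgebra_diagTransposeAlgebra n (by lia),
    ⟨diagTransposeEquiv n, isJordanStarIso_diagTransposeEquiv n, diagTransposeEquiv_apply n⟩,
    not_linearlyCompletelyIsometric_matrixAlgebra_diagTransposeAlgebra hn,
    not_isCompletelyIsometric_transposeOp hn⟩⟩
  · obtain ⟨H, i₁, i₂, i₃, A, B, h⟩ := exists_linearlyCompletelyIsometric_not_jordanIsomorphic
    exact ⟨H, H, i₁, i₂, i₃, i₁, i₂, i₃, A, B, h⟩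
  · exact ⟨_, _, _, _, inferInstance, _, _, inferInstance, matrixAlgebra 2,
      diagTransposeAlgebra 2, isUnitalJCStarAlgebra_matrixAlgebra 2 two_ne_zero,
      isUnitalJCStarAlgebra_diagTransposeAlgebra 2 two_ne_zero,
      ⟨diagTransposeEquiv 2, isJordanStarIso_diagTransposeEquiv 2⟩,
      not_linearlyCompletelyIsometric_matrixAlgebra_diagTransposeAlgebra le_rfl⟩
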